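/- Let $\Lambda$ be an artin algebra, i.e. a ring that is a module-finite algebra over a commutative artinian ring. Let $\operatorname{mod}\Lambda$ be the category of finitely generated right $\Lambda$-modules and $D^b(\operatorname{mod}\Lambda)$ its bounded derived category. For $M\in\operatorname{mod}\Lambda$ put $\Omega^0(M)=M$ and let $\Omega^{n+1}(M)$ be the kernel of a projective cover of $\Omega^n(M)$; let $\operatorname{add}V$ be the class of direct summands of finite direct sums of copies of $V$; and let $S^0(M)$ be the stalk complex with $M$ in degree $0$. For integers $m,n\ge 0$, a module $V\in\operatorname{mod}\Lambda$ is an $(m,n)$-Igusa–Todorov module if for every $M\in\operatorname{mod}\Lambda$ there is an exact sequence $$0\to V_m\to V_{m-1}\to\cdots\to V_1\to V_0\to\Omega^n(M)\to 0$$ with all $V_i\in\operatorname{add}V$; $\Lambda$ is an $(m,n)$-Igusa–Todorov algebra if such a $V$ exists. For an object $X$ of a triangulated category $\mathcal T$, let $\langle X\rangle_1$ be the class of direct summands of finite direct sums of shifts of $X$, and let $\langle X\rangle_{d+1}$ ($d\ge1$) be the class of direct summands of objects $Y$ occurring in a triangle $Y_1\to Y\to Y_2\to Y_1[1]$ with $Y_1\in\langle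 X\rangle_{d}$ and $Y_2\in\langle X\rangle_1$. Let $\operatorname{tri.dim}\mathcal T$ be the least $d\ge 0$ such that $\mathcal T=\langle X\rangle_{d+1}$ for some object $X$, and $\infty$ if there is no such $d$. Theorem. Let $m,n\ge0$ and let $\Lambda$ be an $(m,n)$-Igusa–Todorov algebra. Then $$\operatorname{tri.dim}D^b(\operatorname{mod}\Lambda)\le 2m+\max\{1,n\}.$$ If moreover $n\ge 1$, then $\operatorname{tri.dim}D^b(\operatorname{mod}\Lambda)\le 2m+n$, and for every $(m,n)$-Igusa–Todorov module $V$ one has $$D^b(\operatorname{mod}\Lambda)=\langle S^0(\Lambda)\oplus S^0(V)\rangle_{2m+n+1}.$$ -/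

import Mathlib

open CategoryTheory CategoryTheory.Limits

universe w v u

/-- A ring `Λ` is an artin algebra if it is a module-finite algebra over some commutative artinian
ring.  Taking the base ring in the universe of `Λ` is no restriction, see
`IsArtinAlgebra.of_algebra`. -/
class IsArtinAlgebra (Λ : Type u) [Ring Λ] : Prop where
  exists_base : ∃ (R : Type u) (_ : CommRing R) (_ : IsArtinianRing R) (_ : Algebra R Λ),
    Module.Finite R Λ

theorem IsArtinAlgebra.of_algebra (R : Type v) (Λ : Type u) [CommRing R] [IsArtinianRing R]
    [Ring Λ] [Algebra R Λ] [Module.Finite R Λ] : IsArtinAlgebra Λ := by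
  have h1 : IsArtinian R (Subalgebra.center R Λ) :=
    isArtinian_of_injective (Subalgebra.center R Λ).val.toLinearMap Subtype.val_injective
  have h2 : IsArtinianRing (Subalgebra.center R Λ) := isArtinian_of_tower R h1
  let _ : Algebra (Subalgebra.center R Λ) Λ :=
    RingHom.toAlgebra' (Subalgebra.center R Λ).val.toRingHom
      (fun c x => ((Subalgebra.mem_center_iff.mp c.2) x).symm)
  have : IsScalarTower R (Subalgebra.center R Λ) Λ :=
    IsScalarTower.of_algebraMap_eq (fun _ => rfl)
  have h3 : Module.Finite (Subalgebra.center R Λ) Λ :=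
    Module.Finite.of_restrictScalars_finite R _ _
  exact ⟨⟨Subalgebra.center R Λ, inferInstance, h2, inferInstance, h3⟩⟩

instance IsArtinAlgebra.isNoetherianRing_mulOpposite (Λ : Type u) [Ring Λ] [h : IsArtinAlgebra Λ] :
    IsNoetherianRing Λᵐᵒᵖ := by
  obtain ⟨R, _, _, _, _⟩ := h.exists_base
  have h1 : Module.Finite R Λᵐᵒᵖ :=
    Module.Finite.equiv (MulOpposite.opLinearEquiv R : Λ ≃ₗ[R] Λᵐᵒᵖ)
  exact isNoetherian_of_tower R inferInstance

instance moduleFinite_mulOpposite_self (Λ : Type u) [Ring Λ] : Module.Finite Λᵐᵒᵖ Λ :=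
  ⟨⟨{1}, by
    rw [eq_top_iff]
    intro x _
    have h : x = MulOpposite.op x • (1 : Λ) := by simp
    rw [h]
    exact Submodule.smul_mem _ _ (Submodule.subset_span (by simp))⟩⟩

/-- The category `mod Λ` of finitely generated right `Λ`-modules. -/
abbrev RightMod (Λ : Type u) [Ring Λ] : Type (u + 1) := FGModuleCat.{u} Λᵐᵒᵖ

/-- `Λ` as a right module over itself. -/
abbrev RightMod.self (Λ : Type u) [Ring Λ] : RightMod Λ := FGModuleCat.of Λᵐᵒᵖ Λ

section AbelianNotions

variable {C : Type u} [Category.{v} C] [Abelian C]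

attribute [local instance] Abelian.hasFiniteBiproducts

/-- A projective cover: an essential epimorphism from a projective object. -/
structure IsProjectiveCover {P X : C} (f : P ⟶ X) : Prop where
  projective : Projective P
  epi : Epi f
  essential : ∀ ⦃Q : C⦄ (g : Q ⟶ P), Epi (g ≫ f) → Epi g

/-- `IsSyzygy n X K` says that `K` is (isomorphic to) the `n`-th syzygy `Ωⁿ(X)`: `Ω⁰(X) = X`, and
`Ωⁿ⁺¹(X)` is the kernel of a projective cover of `Ωⁿ(X)`. -/
def IsSyzygy : ℕ → C → C → Prop
  | 0, X, K => Nonempty (K ≅ X)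
  | n + 1, X, K => ∃ (L P : C) (f : P ⟶ L),
      IsSyzygy n X L ∧ IsProjectiveCover f ∧ Nonempty (K ≅ kernel f)

/-- `InAdd V X` says that `X` belongs to `add V`: it is a direct summand of a finite direct sum of
copies of `V`. -/
def InAdd (V X : C) : Prop :=
  ∃ k : ℕ, Nonempty (Retract X (⨁ fun _ : Fin k => V))

/-- There is an exact sequence `0 ⟶ V_m ⟶ ⋯ ⟶ V_1 ⟶ V_0 ⟶ K ⟶ 0` with all `V_i` in `add V`
(the sequence is continued by zero objects in degrees `> m`). -/
def HasAddResolution (V : C) (m : ℕ) (K : C) : Prop :=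
  ∃ (W : ℕ → C) (d : ∀ i, W (i + 1) ⟶ W i) (ε : W 0 ⟶ K)
    (hε : d 0 ≫ ε = 0) (hd : ∀ i, d (i + 1) ≫ d i = 0),
    (∀ i ≤ m, InAdd V (W i)) ∧ (∀ i, m < i → IsZero (W i)) ∧
    Epi ε ∧ (ShortComplex.mk (d 0) ε hε).Exact ∧
    ∀ i, (ShortComplex.mk (d (i + 1)) (d i) (hd i)).Exact

end AbelianNotions

/-- `V` is an `(m,n)`-Igusa–Todorov module: for every `M` in `mod Λ` there is an exact sequence
`0 ⟶ V_m ⟶ ⋯ ⟶ V_0 ⟶ Ωⁿ(M) ⟶ 0` with all `V_i` in `add V`. -/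
def IsIgusaTodorovModule {Λ : Type u} [Ring Λ] [IsArtinAlgebra Λ] (m n : ℕ)
    (V : RightMod Λ) : Prop :=
  ∀ M : RightMod Λ, ∃ K : RightMod Λ, IsSyzygy n M K ∧ HasAddResolution V m K

/-- `Λ` is an `(m,n)`-Igusa–Todorov algebra: it has an `(m,n)`-Igusa–Todorov module. -/
def IsIgusaTodorovAlgebra (Λ : Type u) [Ring Λ] [IsArtinAlgebra Λ] (m n : ℕ) : Prop :=
  ∃ V : RightMod Λ, IsIgusaTodorovModule m n V

section Triangulated

variable {T : Type u} [Category.{v} T] [HasZeroObject T] [HasShift T ℤ] [Preadditive T]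
  [∀ k : ℤ, (shiftFunctor T k).Additive] [Pretriangulated T]

/-- `GeneratesInSteps M (d + 1)` says `T = ⟨M⟩_{d+1}`: every object is obtained from shifts of `M`
by finite direct sums, direct summands and `d` extensions.  (Mathlib's `triangEnvelopeIter` counts
extensions, so that `triangEnvelopeIter d` is `⟨M⟩_{d+1}`.)  Moreover `⟨M⟩_0 = 0`. -/
def GeneratesInSteps (M : T) : ℕ → Prop
  | 0 => ∀ X : T, IsZero X
  | d + 1 => (ObjectProperty.singleton M).triangEnvelopeIter d = ⊤

variable (T) in
/-- The dimension of a triangulated category: the least `d` such that `T = ⟨M⟩_{d+1}` for some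
object `M`, and `∞` if there is no such `d`. -/
noncomputable def triangDim : ℕ∞ :=
  ⨅ (d : ℕ) (_ : ∃ M : T, GeneratesInSteps M (d + 1)), (d : ℕ∞)

end Triangulated

section Bounded

variable (C : Type u) [Category.{v} C] [Abelian C] [HasDerivedCategory.{w} C]

/-- The functor `S⁰` sending an object to the stalk complex in degree `0`, with values in the
bounded derived category. -/
noncomputable def stalkZero : C ⥤ DerivedCategory.Bounded C :=
  (DerivedCategory.TStructure.t (C := C)).bounded.lift (DerivedCategory.singleFunctor C 0)
    (fun _ => ⟨⟨0, inferInstance⟩, ⟨0, inferInstance⟩⟩)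

end Bounded

/-! Represent a bounded object `X` by a bounded complex of projectives, cut off below by a syzygy
that embeds in the next projective. Its cycles and its shifted boundaries form complexes with zero
differential, and both consist of subobjects of projectives. So `X` is an extension of two finite
sums of shifted first syzygies (`exists_triangle_isStalkSum`). The argument is carried out with
triangles, attaching one object at a time (`HasCycleBoundaryTriangle.cone`).

An extension of two sums of `k`-th syzygies becomes one of two sums of `(k + 1)`-th syzygies after
splitting off one layer of projective stalks (`exists_syzygy_triangle`). Doing this `n - 1` times
leaves `n`-th syzygies. By Schanuel's lemma such a syzygy is a retract of some `Ωⁿ(M) ⊞ Q` with `Q`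
projective (`IsWeakSyzygy.exists_retract`), and the resolution of `Ωⁿ(M)` by `add V` builds it in `m
+ 1` layers. The total is `2(m + 1) + (n - 1) = 2m + n + 1` layers. For `n = 0` the two sums of
first syzygies remain, which gives `2m + 2` layers. -/

/-! ### Octahedral manipulations of extensions. -/

section TriangulatedLemmas

open Pretriangulated Triangulated Category

variable {T : Type u} [Category.{v} T] [HasZeroObject T] [HasShift T ℤ] [Preadditive T]
  [∀ k : ℤ, (shiftFunctor T k).Additive] [Pretriangulated T]

/-- Transport of a distinguished triangle along an isomorphism of the third objects. -/
lemma distinguished_of_iso₃ {X Y Z Z' : T} {f : X ⟶ Y} {g : Y ⟶ Z} {h : Z ⟶ X⟦(1 : ℤ)⟧}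
    (H : Triangle.mk f g h ∈ distTriang T) (e : Z ≅ Z') :
    Triangle.mk f (g ≫ e.hom) (e.inv ≫ h) ∈ distTriang T :=
  isomorphic_distinguished _ H _ (Triangle.isoMk _ _ (Iso.refl _) (Iso.refl _) e.symm
    ((comp_id f).trans (id_comp f).symm)
    (show (g ≫ e.hom) ≫ e.inv = 𝟙 Y ≫ g by simp)
    (show (e.inv ≫ h) ≫ (𝟙 X)⟦(1 : ℤ)⟧' = e.inv ≫ h by simp))

/-- Transport of a distinguished triangle along an isomorphism of the first objects. -/
lemma distinguished_of_iso₁ {X X' Y Z : T} {f : X ⟶ Y} {g : Y ⟶ Z} {h : Z ⟶ X⟦(1 : ℤ)⟧}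
    (H : Triangle.mk f g h ∈ distTriang T) (e : X' ≅ X) :
    Triangle.mk (e.hom ≫ f) g (h ≫ e.inv⟦(1 : ℤ)⟧') ∈ distTriang T :=
  isomorphic_distinguished _ H _ (Triangle.isoMk _ _ e (Iso.refl _) (Iso.refl _)
    (comp_id _) ((comp_id g).trans (id_comp g).symm)
    (show (h ≫ e.inv⟦(1 : ℤ)⟧') ≫ e.hom⟦(1 : ℤ)⟧' = 𝟙 Z ≫ h by
      rw [assoc, ← CategoryTheory.Functor.map_comp, e.inv_hom_id, CategoryTheory.Functor.map_id,
        comp_id, id_comp]))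

/-- Two distinguished triangles on the same morphism have isomorphic third objects. -/
lemma exists_iso_cone {X Y Z Z' : T} {f : X ⟶ Y} {g : Y ⟶ Z} {h : Z ⟶ X⟦(1 : ℤ)⟧}
    (H : Triangle.mk f g h ∈ distTriang T) {g' : Y ⟶ Z'} {h' : Z' ⟶ X⟦(1 : ℤ)⟧}
    (H' : Triangle.mk f g' h' ∈ distTriang T) : ∃ e : Z ≅ Z', g ≫ e.hom = g' := by
  let φ := isoTriangleOfIso₁₂ _ _ H H' (Iso.refl _) (Iso.refl _)
    ((comp_id f).trans (id_comp f).symm)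
  refine ⟨Triangle.π₃.mapIso φ, φ.hom.comm₂.trans ?_⟩
  change 𝟙 Y ≫ g' = g'
  exact id_comp g'

section Exactness

variable {X Y Z A : T} {f : X ⟶ Y} {g : Y ⟶ Z} {h : Z ⟶ X⟦(1 : ℤ)⟧}

lemma exists_lift₁ (H : Triangle.mk f g h ∈ distTriang T)
    (x : A ⟶ X⟦(1 : ℤ)⟧) (hx : x ≫ f⟦(1 : ℤ)⟧' = 0) : ∃ y : A ⟶ Z, x = y ≫ h :=
  Triangle.coyoneda_exact₁ _ H x hx

lemma exists_lift₂ (H : Triangle.mk f g h ∈ distTriang T)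
    (x : A ⟶ Y) (hx : x ≫ g = 0) : ∃ y : A ⟶ X, x = y ≫ f :=
  Triangle.coyoneda_exact₂ _ H x hx

lemma exists_lift₃ (H : Triangle.mk f g h ∈ distTriang T)
    (x : A ⟶ Z) (hx : x ≫ h = 0) : ∃ y : A ⟶ Y, x = y ≫ g :=
  Triangle.coyoneda_exact₃ _ H x hx

lemma exists_desc₂ (H : Triangle.mk f g h ∈ distTriang T)
    (x : Y ⟶ A) (hx : f ≫ x = 0) : ∃ y : Z ⟶ A, x = g ≫ y :=
  Triangle.yoneda_exact₂ _ H x hx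

lemma exists_desc₃ (H : Triangle.mk f g h ∈ distTriang T)
    (x : Z ⟶ A) (hx : g ≫ x = 0) : ∃ y : X⟦(1 : ℤ)⟧ ⟶ A, x = h ≫ y :=
  Triangle.yoneda_exact₃ _ H x hx

lemma comp_eq_zero₁₂ (H : Triangle.mk f g h ∈ distTriang T) : f ≫ g = 0 :=
  comp_distTriang_mor_zero₁₂ _ H

lemma comp_eq_zero₂₃ (H : Triangle.mk f g h ∈ distTriang T) : g ≫ h = 0 :=
  comp_distTriang_mor_zero₂₃ _ H

lemma comp_eq_zero₃₁ (H : Triangle.mk f g h ∈ distTriang T) : h ≫ f⟦(1 : ℤ)⟧' = 0 :=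
  comp_distTriang_mor_zero₃₁ _ H

end Exactness

variable [IsTriangulated T]

/-- If `W` is an extension of `E` by `Z` and `I ⟶ W` factors through `Z`, then the cone of
`I ⟶ W` is an extension of `E ⊞ I⟦1⟧` by `Z`. -/
lemma exists_triangle_cone_of_factors {Z W E I W' : T} {z : Z ⟶ W} {e : W ⟶ E}
    {d : E ⟶ Z⟦(1 : ℤ)⟧} (H : Triangle.mk z e d ∈ distTriang T) (s : I ⟶ Z)
    {p : W ⟶ W'} {q : W' ⟶ I⟦(1 : ℤ)⟧} (H' : Triangle.mk (s ≫ z) p q ∈ distTriang T) :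
    ∃ (E' : T) (e' : W' ⟶ E') (d' : E' ⟶ Z⟦(1 : ℤ)⟧),
      Triangle.mk (z ≫ p) e' d' ∈ distTriang T ∧ Nonempty (E' ≅ E ⊞ I⟦(1 : ℤ)⟧) := by
  obtain ⟨E', e', d', H''⟩ := distinguished_cocone_triangle (z ≫ p)
  -- The octahedron on `Z ⟶ W ⟶ W'` gives a triangle `E ⟶ E' ⟶ I⟦1⟧`. Its connecting map passes
  -- through `z ≫ e = 0`, so it splits.
  let o := someOctahedron rfl H (rot_of_distTriang _ H') H''
  have hze : z ≫ e = 0 := comp_distTriang_mor_zero₁₂ _ H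
  have h0 : (Triangle.mk o.m₁ o.m₃ ((-(s ≫ z)⟦(1 : ℤ)⟧') ≫ e⟦(1 : ℤ)⟧')).mor₃ = 0 := by
    change (-(s ≫ z)⟦(1 : ℤ)⟧') ≫ e⟦(1 : ℤ)⟧' = 0
    rw [Preadditive.neg_comp, ← Functor.map_comp, assoc, hze, comp_zero, Functor.map_zero, neg_zero]
  obtain ⟨i, -, -⟩ := exists_iso_binaryBiproduct_of_distTriang _ o.mem h0
  exact ⟨E', e', d', H'', ⟨i⟩⟩

/-- If `W` is an extension of `W'` by `K` and `W'` is an extension of `E` by `Z`, such that the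
composition `Z ⟶ W' ⟶ K⟦1⟧` vanishes, then `W` is an extension of `E` by `K ⊞ Z`. -/
lemma exists_triangle_of_lift {K W W' Z E : T} {k : K ⟶ W} {r : W ⟶ W'} {t : W' ⟶ K⟦(1 : ℤ)⟧}
    (H : Triangle.mk k r t ∈ distTriang T) {z : Z ⟶ W'} {e : W' ⟶ E} {d : E ⟶ Z⟦(1 : ℤ)⟧}
    (H' : Triangle.mk z e d ∈ distTriang T) (hzt : z ≫ t = 0) :
    ∃ (z' : K ⊞ Z ⟶ W) (d' : E ⟶ (K ⊞ Z)⟦(1 : ℤ)⟧),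
      Triangle.mk z' (r ≫ e) d' ∈ distTriang T := by
  obtain ⟨l, hl⟩ := exists_lift₃ H z hzt
  obtain ⟨E', e', d', H''⟩ := distinguished_cocone_triangle (biprod.desc k l)
  -- The octahedron on `K ⟶ K ⊞ Z ⟶ W` makes the cone of `biprod.desc k l` a cone of `Z ⟶ W'`. That
  -- map is `z`, so this cone is `E`.
  let o := someOctahedron (u₁₃ := k) (by simp) (binaryBiproductTriangle_distinguished K Z) H'' H
  have hm : o.m₁ = z := by
    have := o.comm₁
    rw [hl, ← biprod.inr_snd_assoc (X := K) (Y := Z) o.m₁, this]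
    simp
  obtain ⟨m, hm'⟩ : ∃ m, Triangle.mk z o.m₃ m ∈ distTriang T := ⟨_, hm ▸ o.mem⟩
  obtain ⟨i, hi⟩ := exists_iso_cone hm' H'
  have h := distinguished_of_iso₃ H'' i
  rw [← o.comm₃, assoc, hi] at h
  exact ⟨_, _, h⟩

end TriangulatedLemmas

/-! ### Weak syzygies, stalk sums and the cycle-boundary triangle. -/

section DerivedLemmas

open Pretriangulated Triangulated Category DerivedCategory ZeroObject

attribute [local instance] preservesBinaryBiproducts_of_preservesBiproducts

variable {C : Type u} [Category.{v} C] [Abelian C]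

/-- `IsWeakSyzygy k K` says that `K` is a `k`-th syzygy of some object, computed with arbitrary
projective objects instead of projective covers. -/
def IsWeakSyzygy : ℕ → ObjectProperty C
  | 0 => ⊤
  | k + 1 => fun K => ∃ (P L : C) (i : K ⟶ P) (p : P ⟶ L) (w : i ≫ p = 0),
      (ShortComplex.mk i p w).ShortExact ∧ Projective P ∧ IsWeakSyzygy k L

/-- The subobjects of projective objects are first syzygies. -/
lemma isWeakSyzygy_one_of_mono {K P : C} [Projective P] (i : K ⟶ P) [Mono i] :
    IsWeakSyzygy 1 K :=
  ⟨P, cokernel i, i, cokernel.π i, by simp,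
    { exact := ShortComplex.exact_cokernel i }, inferInstance, trivial⟩

lemma IsWeakSyzygy.of_mono {K A : C} (hA : IsWeakSyzygy 1 A) (i : K ⟶ A) [Mono i] :
    IsWeakSyzygy 1 K := by
  obtain ⟨P, L, j, p, w, h, hP, -⟩ := hA
  have : Mono j := h.mono_f
  exact isWeakSyzygy_one_of_mono (i ≫ j)

/-- Take `P` as a syzygy of zero. Projective summands can then be absorbed among the syzygies of any
order. -/
lemma isWeakSyzygy_of_projective (k : ℕ) (P : C) [Projective P] : IsWeakSyzygy k P := by
  have h0 : ∀ j : ℕ, IsWeakSyzygy j (0 : C) := by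
    intro j
    induction j with
    | zero => trivial
    | succ j ih =>
      exact ⟨0, 0, 0, 0, by simp,
        { exact := ShortComplex.exact_of_isZero_X₂ _ (isZero_zero C)
          mono_f := ⟨fun _ _ _ => (isZero_zero C).eq_of_tgt _ _⟩
          epi_g := ⟨fun _ _ _ => (isZero_zero C).eq_of_src _ _⟩ }, inferInstance, ih⟩
  cases k with
  | zero => trivial
  | succ k =>
    exact ⟨P, 0, 𝟙 P, 0, by simp,
      { exact := (ShortComplex.exact_iff_epi _ (by simp)).2 (by dsimp; infer_instance)
        mono_f := by dsimp; infer_instance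
        epi_g := ⟨fun _ _ _ => (isZero_zero C).eq_of_src _ _⟩ }, inferInstance, h0 k⟩

variable [HasDerivedCategory.{w} C]

/-- The finite direct sums of stalk complexes of objects satisfying `P`. -/
inductive IsStalkSum (P : ObjectProperty C) : DerivedCategory C → Prop
  | single (M : C) (n : ℤ) (h : P M) : IsStalkSum P ((singleFunctor C n).obj M)
  | biprod {X Y : DerivedCategory C} (hX : IsStalkSum P X) (hY : IsStalkSum P Y) :
      IsStalkSum P (X ⊞ Y)
  | of_iso {X Y : DerivedCategory C} (e : X ≅ Y) (hX : IsStalkSum P X) : IsStalkSum P Y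

/-- The stalk complex in degree `b` shifted by `1` is the stalk complex in degree `a`, when
`b = a + 1`. -/
noncomputable def singleShiftIso (M : C) (n a b : ℤ) (h : n + a = b) :
    ((singleFunctor C b).obj M)⟦n⟧ ≅ (singleFunctor C a).obj M :=
  ((singleFunctors C).shiftIso n a b h).app M

lemma IsStalkSum.shift {P : ObjectProperty C} {X : DerivedCategory C} (h : IsStalkSum P X)
    (n : ℤ) : IsStalkSum P (X⟦n⟧) := by
  induction h with
  | single M b h => exact .of_iso (singleShiftIso M n (b - n) b (by lia)).symm (.single M _ h)
  | biprod hX hY h1 h2 => exact .of_iso ((shiftFunctor _ n).mapBiprod _ _).symm (.biprod h1 h2)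
  | of_iso e hX h => exact .of_iso ((shiftFunctor _ n).mapIso e) h

lemma IsStalkSum.of_le {P Q : ObjectProperty C} (hPQ : P ≤ Q) {X : DerivedCategory C}
    (h : IsStalkSum P X) : IsStalkSum Q X := by
  induction h with
  | single M b h => exact .single M b (hPQ M h)
  | biprod hX hY h1 h2 => exact .biprod h1 h2
  | of_iso e hX h => exact .of_iso e h

lemma exists_stalk_triangle {K P L : C} (i : K ⟶ P) (p : P ⟶ L) (w : i ≫ p = 0)
    (h : (ShortComplex.mk i p w).ShortExact) (n : ℤ) :
    ∃ δ, Triangle.mk ((singleFunctor C n).map i) ((singleFunctor C n).map p) δ ∈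
      distTriang (DerivedCategory C) :=
  ⟨_, triangleOfSES_distinguished
    (h.map_of_exact (HomologicalComplex.single C (ComplexShape.up ℤ) n))⟩

lemma eq_zero_of_projective_of_isLE {P : C} [Projective P] {i n : ℤ} (hn : n < i)
    {X : DerivedCategory C} [X.IsLE n] (f : (singleFunctor C i).obj P ⟶ X) : f = 0 := by
  obtain ⟨K, _, ⟨e⟩⟩ := exists_iso_Q_obj_of_isLE X n
  rw [← cancel_mono e.hom, zero_comp]
  exact from_singleFunctor_obj_eq_zero_of_projective _ n hn

lemma isGE_biprod (X Y : DerivedCategory C) (n : ℤ) [hX : X.IsGE n] [hY : Y.IsGE n] :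
    (X ⊞ Y).IsGE n :=
  TStructure.t.isGE₂ _ (binaryBiproductTriangle_distinguished X Y) n hX hY

/-- The condition that `W` is the brutal truncation in degrees `≥ a` of a bounded above complex of
projective objects, expressed in terms of the triangle relating `W` to its cycles (which are
`A` in degree `a`) and its boundaries. -/
def HasCycleBoundaryTriangle (a : ℤ) (W : DerivedCategory C) : Prop :=
  W.IsGE a ∧ ∃ (A : C) (Z E : DerivedCategory C) (z : (singleFunctor C a).obj A ⊞ Z ⟶ W)
    (e : W ⟶ E) (d : E ⟶ ((singleFunctor C a).obj A ⊞ Z)⟦(1 : ℤ)⟧),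
    Triangle.mk z e d ∈ distTriang (DerivedCategory C) ∧
    IsWeakSyzygy 1 A ∧ IsStalkSum (IsWeakSyzygy 1) Z ∧ Z.IsGE (a + 1) ∧
    IsStalkSum (IsWeakSyzygy 1) E ∧ E.IsGE a ∧
    ∀ (M : C) (g : (singleFunctor C a).obj M ⟶ W), g ≫ e = 0

/-- The only new cohomology is the kernel of `I ⟶ H^a(W)` in degree `a - 1`. It vanishes because `j`
is mono and, as `E` lives in degrees `≥ a`, so is `A ⟶ H^a(W)`. The proof expresses this by
orthogonality. -/
lemma isGE_cone_of_mono {a : ℤ} {W E Z W' : DerivedCategory C} [W.IsGE a] [E.IsGE a]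
    {I A : C} (j : I ⟶ A) [Mono j] {z : (singleFunctor C a).obj A ⊞ Z ⟶ W}
    {e : W ⟶ E} {d : E ⟶ ((singleFunctor C a).obj A ⊞ Z)⟦(1 : ℤ)⟧}
    (H : Triangle.mk z e d ∈ distTriang (DerivedCategory C))
    {p : W ⟶ W'} {q : W' ⟶ ((singleFunctor C a).obj I)⟦(1 : ℤ)⟧}
    (H' : Triangle.mk (((singleFunctor C a).map j ≫ biprod.inl) ≫ z) p q ∈
      distTriang (DerivedCategory C)) : W'.IsGE a := by
  refine (TStructure.t.isGE_iff_orthogonal (a - 1) a (by lia) W').2 fun Y f hY => ?_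
  have h1 : (f ≫ q) ≫ (((singleFunctor C a).map j ≫ biprod.inl) ≫ z)⟦(1 : ℤ)⟧' = 0 := by
    rw [assoc, comp_eq_zero₃₁ H', comp_zero]
  rw [CategoryTheory.Functor.map_comp, ← assoc] at h1
  obtain ⟨v, hv⟩ := exists_lift₁ H _ h1
  have hv0 : v = 0 := TStructure.t.zero_of_isLE_of_isGE v (a - 1) a (by lia) hY ‹_›
  rw [hv0, zero_comp] at hv
  have h2 : (f ≫ q) ≫ ((singleFunctor C a).map j)⟦(1 : ℤ)⟧' = 0 := by
    have h3 := congrArg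
      (· ≫ (biprod.fst : (singleFunctor C a).obj A ⊞ Z ⟶ _)⟦(1 : ℤ)⟧') hv
    simp only [zero_comp] at h3
    rw [← h3, assoc (f ≫ q), ← CategoryTheory.Functor.map_comp, assoc ((singleFunctor C a).map j),
      biprod.inl_fst, comp_id]
  obtain ⟨δ, Hδ⟩ := exists_stalk_triangle j (cokernel.π j) (by simp)
    { exact := ShortComplex.exact_cokernel j } a
  obtain ⟨v', hv'⟩ := exists_lift₁ Hδ _ h2
  have hv0' : v' = 0 := TStructure.t.zero_of_isLE_of_isGE v' (a - 1) a (by lia) hY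
    (inferInstanceAs (((singleFunctor C a).obj (cokernel j)).IsGE a))
  rw [hv0', zero_comp] at hv'
  obtain ⟨f', hf'⟩ := exists_lift₃ H' f hv'
  rw [hf', TStructure.t.zero_of_isLE_of_isGE f' (a - 1) a (by lia) hY ‹_›, zero_comp]

/-- The inductive step of the construction of cycle-boundary triangles: attaching an object `M` in
degree `a - 1`. -/
lemma HasCycleBoundaryTriangle.cone {a : ℤ} {W W' : DerivedCategory C}
    (h : HasCycleBoundaryTriangle a W) {M : C} {g : (singleFunctor C a).obj M ⟶ W}
    {p : W ⟶ W'} {q : W' ⟶ ((singleFunctor C a).obj M)⟦(1 : ℤ)⟧}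
    (H : Triangle.mk g p q ∈ distTriang (DerivedCategory C))
    (hM : ∀ (K : C) (k : K ⟶ M), Mono k → (singleFunctor C a).map k ≫ g = 0 →
      IsWeakSyzygy 1 K) : HasCycleBoundaryTriangle (a - 1) W' := by
  obtain ⟨hW, A, Z, E, z, e, d, Hz, hA, hZ, hZa, hE, hEa, he⟩ := h
  -- The differential `g` lands in the cycles, and for degree reasons in the summand `A`. Its image
  -- `I` is the new boundary and its kernel the new bottom cycle object.
  obtain ⟨y, hy⟩ := exists_lift₂ Hz g (he M g)
  obtain ⟨g0, hg0⟩ := (singleFunctor C a).map_surjective (y ≫ biprod.fst)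
  have hy' : y = (singleFunctor C a).map g0 ≫ biprod.inl := by
    apply biprod.hom_ext
    · rw [hg0, assoc, biprod.inl_fst, comp_id]
    · rw [assoc, biprod.inl_snd, comp_zero]
      exact TStructure.t.zero_of_isLE_of_isGE _ a (a + 1) (by lia) inferInstance hZa
  obtain ⟨I, ε, j, _, _, hεj⟩ : ∃ (I : C) (ε : M ⟶ I) (j : I ⟶ A), Epi ε ∧ Mono j ∧ ε ≫ j = g0 :=
    ⟨_, factorThruImage g0, image.ι g0, inferInstance, inferInstance, image.fac g0⟩
  have hg : g = (singleFunctor C a).map ε ≫ (((singleFunctor C a).map j ≫ biprod.inl) ≫ z) := by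
    rw [hy, hy', ← hεj, CategoryTheory.Functor.map_comp]
    simp only [assoc]
  have hK : IsWeakSyzygy 1 (kernel ε) := by
    refine hM _ (kernel.ι ε) inferInstance ?_
    rw [hg, ← assoc, ← CategoryTheory.Functor.map_comp, kernel.condition]
    simp
  have hI : IsWeakSyzygy 1 I := hA.of_mono j
  obtain ⟨W'', p', q', H'⟩ :=
    distinguished_cocone_triangle (((singleFunctor C a).map j ≫ biprod.inl) ≫ z)
  have hW'' : W''.IsGE a := isGE_cone_of_mono j Hz H'
  obtain ⟨E', e', d', HE', ⟨φ⟩⟩ := exists_triangle_cone_of_factors Hz _ H'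
  obtain ⟨δ, Hδ⟩ := exists_stalk_triangle (kernel.ι ε) ε (by simp)
    { exact := ShortComplex.exact_kernel ε } a
  -- Factoring `g` through its image exhibits `W'` as an extension of `W''`, the cone of `I ⟶ W`, by
  -- `(kernel ε)⟦1⟧`. The old cycles map to zero in `I⟦1⟧`, hence lift to `W'`.
  let o := someOctahedron hg.symm (rot_of_distTriang _ Hδ) H' H
  obtain ⟨z', d'', Hz'⟩ := exists_triangle_of_lift o.mem HE'
    (by rw [assoc, ← assoc p', comp_eq_zero₂₃ H', zero_comp, comp_zero])
  let ψ : (singleFunctor C (a - 1)).obj (kernel ε) ≅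
    ((singleFunctor C a).obj (kernel ε))⟦(1 : ℤ)⟧ :=
      (singleShiftIso (kernel ε) 1 (a - 1) a (by lia)).symm
  have hsh : ∀ N : C, IsGE (((singleFunctor C a).obj N)⟦(1 : ℤ)⟧) (a - 1) := fun N =>
    TStructure.t.isGE_shift _ a 1 (a - 1)
  have := hsh (kernel ε)
  have := hsh I
  have hE'a : E'.IsGE (a - 1) := by
    have : E.IsGE (a - 1) := TStructure.t.isGE_of_ge E (a - 1) a
    have := isGE_biprod E (((singleFunctor C a).obj I)⟦(1 : ℤ)⟧) (a - 1)
    exact TStructure.t.isGE_of_iso φ.symm (a - 1)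
  have hZ' : Z.IsGE a := TStructure.t.isGE_of_ge Z a (a + 1)
  refine ⟨TStructure.t.isGE₂ _ o.mem (a - 1) (hsh _) (TStructure.t.isGE_of_ge W'' (a - 1) a),
    kernel ε, (singleFunctor C a).obj A ⊞ Z, E', _, _, _,
    distinguished_of_iso₁ Hz' (biprod.mapIso ψ (Iso.refl _)), hK, .biprod (.single _ _ hA) hZ, ?_,
    .of_iso φ.symm (.biprod hE (.shift (.single _ _ hI) 1)), hE'a, fun N f => ?_⟩
  · rw [sub_add_cancel]
    exact isGE_biprod _ _ _
  · rw [← assoc, TStructure.t.zero_of_isLE_of_isGE (f ≫ o.m₃) (a - 1) a (by lia)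
      inferInstance hW'', zero_comp]

end DerivedLemmas

/-! ### Projective approximation of bounded objects. -/

section CycleBoundary

open Pretriangulated Triangulated Category DerivedCategory ZeroObject

variable {C : Type u} [Category.{v} C] [Abelian C] [HasDerivedCategory.{w} C]

/-- Map a projective `P` onto the top cohomology `N` of `X`. The obstruction to lifting it to `X`
lies in degrees `≤ c - 2`, where projective stalks in degree `c` do not map. Since `P ⟶ N` is epi,
the cone has no cohomology left in degree `c`. -/
lemma exists_projective_triangle_of_isLE [EnoughProjectives C] (X : DerivedCategory C) (c : ℤ)
    [hX : X.IsLE c] :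
    ∃ (P : C) (Y : DerivedCategory C) (f : (singleFunctor C c).obj P ⟶ X) (p : X ⟶ Y)
      (q : Y ⟶ ((singleFunctor C c).obj P)⟦(1 : ℤ)⟧),
      Triangle.mk f p q ∈ distTriang (DerivedCategory C) ∧ Projective P ∧ Y.IsLE (c - 1) := by
  obtain ⟨X₁, Y₁, hX₁, hY₁, α, β₁, γ₁, H₁⟩ :=
    TStructure.t.exists_triangle X (c - 1) c (by lia)
  have hX₁ : X₁.IsLE (c - 1) := ⟨hX₁⟩
  have hY₁ : Y₁.IsGE c := ⟨hY₁⟩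
  have hX₁' : IsLE (X₁⟦(1 : ℤ)⟧) (c - 2) := TStructure.t.isLE_shift X₁ (c - 1) 1 (c - 2)
  have : Y₁.IsLE c := TStructure.t.isLE₂ _ (rot_of_distTriang _ H₁) c hX
    (TStructure.t.isLE_of_le (X₁⟦(1 : ℤ)⟧) (c - 2) c)
  obtain ⟨N, ⟨i⟩⟩ := exists_iso_singleFunctor_obj_of_isGE_of_isLE Y₁ c
  obtain ⟨β, γ, H⟩ : ∃ (β : X ⟶ (singleFunctor C c).obj N) (γ : _ ⟶ X₁⟦(1 : ℤ)⟧),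
    Triangle.mk α β γ ∈ distTriang (DerivedCategory C) := ⟨_, _, distinguished_of_iso₃ H₁ i⟩
  obtain ⟨f, hf⟩ := exists_lift₃ H ((singleFunctor C c).map (Projective.π N))
    (eq_zero_of_projective_of_isLE (n := c - 2) (by lia) _)
  obtain ⟨Y, p, q, HY⟩ := distinguished_cocone_triangle f
  refine ⟨_, Y, f, p, q, HY, inferInstance, ?_⟩
  refine (TStructure.t.isLE_iff_orthogonal (c - 1) c (by lia) Y).2 fun V y hV => ?_
  have h1 : p ≫ y = 0 := by
    obtain ⟨y', hy'⟩ := exists_desc₂ H (p ≫ y)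
      (TStructure.t.zero_of_isLE_of_isGE _ (c - 1) c (by lia) hX₁ hV)
    obtain ⟨δ, Hδ⟩ := exists_stalk_triangle (kernel.ι (Projective.π N)) (Projective.π N) (by simp)
      { exact := ShortComplex.exact_kernel _ } c
    have h2 : (singleFunctor C c).map (Projective.π N) ≫ y' = 0 := by
      rw [hf, assoc, ← hy', ← assoc, comp_eq_zero₁₂ HY, zero_comp]
    obtain ⟨y'', hy''⟩ := exists_desc₃ Hδ y' h2
    have h3 : y'' = 0 := TStructure.t.zero_of_isLE_of_isGE y'' (c - 1) c (by lia)
      (TStructure.t.isLE_shift _ c 1 (c - 1)) hV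
    rw [hy', hy'', h3, comp_zero, comp_zero]
  obtain ⟨y', hy'⟩ := exists_desc₃ HY y h1
  have h3 : y' = 0 := TStructure.t.zero_of_isLE_of_isGE y' (c - 1) c (by lia)
    (TStructure.t.isLE_shift _ c 1 (c - 1)) hV
  rw [hy', h3, comp_zero]

lemma hasCycleBoundaryTriangle_zero (a : ℤ) :
    HasCycleBoundaryTriangle a (0 : DerivedCategory C) := by
  have h0 : IsWeakSyzygy 1 (0 : C) := isWeakSyzygy_of_projective 1 0
  have hs : IsZero ((singleFunctor C a).obj 0) := (singleFunctor C a).map_isZero (isZero_zero C)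
  have hb : IsZero ((singleFunctor C a).obj (0 : C) ⊞ (singleFunctor C a).obj (0 : C)) :=
    Triangle.isZero₂_of_isZero₁₃ _ (binaryBiproductTriangle_distinguished _ _) hs hs
  have hS : IsStalkSum (IsWeakSyzygy 1) ((singleFunctor C a).obj 0) := .single _ _ h0
  refine ⟨TStructure.t.isGE_of_isZero (isZero_zero _) a, 0, (singleFunctor C a).obj 0,
    (singleFunctor C a).obj 0, 0, 0, 0, ?_, h0, hS, TStructure.t.isGE_of_isZero hs _, hS,
    inferInstance, fun M g => comp_zero⟩
  exact (Triangle.distinguished_iff_of_isZero₃ _ hs).2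
    ⟨0, hb.eq_of_src _ _, (isZero_zero (DerivedCategory C)).eq_of_src _ _⟩

/-- This is a projective resolution of `X` built downwards from degree `b`: `W` collects the top `j`
projectives and `Y` is what remains to be resolved. -/
lemma exists_cycleBoundary_approximation [EnoughProjectives C] (X : DerivedCategory C) (b : ℤ)
    [X.IsLE b] (j : ℕ) :
    ∃ (W Y : DerivedCategory C) (f : W ⟶ X) (p : X ⟶ Y) (q : Y ⟶ W⟦(1 : ℤ)⟧),
      Triangle.mk f p q ∈ distTriang (DerivedCategory C) ∧ Y.IsLE (b - j) ∧
      HasCycleBoundaryTriangle (b - j + 1) W := by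
  induction j with
  | zero =>
    refine ⟨0, X, 0, 𝟙 X, 0, contractible_distinguished₁ X, ?_, hasCycleBoundaryTriangle_zero _⟩
    rwa [Nat.cast_zero, sub_zero]
  | succ j ih =>
    obtain ⟨W, Y, f, p, q, H, hY, hW⟩ := ih
    obtain ⟨P, Y', g, r, t, H', hP, hY'⟩ := exists_projective_triangle_of_isLE Y (b - j)
    obtain ⟨W', f', q', H''⟩ := distinguished_cocone_triangle₁ (p ≫ r)
    let o := someOctahedron' rfl H H' H''
    let H₀ := inv_rot_of_distTriang _ o.mem
    let φ := singleShiftIso P (-1) (b - j + 1) (b - j) (by lia)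
    refine ⟨W', Y', f', p ≫ r, q', H'', ?_, ?_⟩
    · rwa [Nat.cast_succ, ← sub_sub]
    · have := hW.cone (distinguished_of_iso₁ H₀ φ.symm) (fun K k _ _ => isWeakSyzygy_one_of_mono k)
      rwa [show b - ((j + 1 : ℕ) : ℤ) + 1 = b - j + 1 - 1 by push_cast; ring]

/-- In a category with enough projectives, every bounded object of the derived category is an
extension of finite direct sums of stalk complexes of first syzygies. -/
lemma exists_triangle_isStalkSum [EnoughProjectives C] (X : DerivedCategory C) (a b : ℤ)
    [hXa : X.IsGE a] [X.IsLE b] :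
    ∃ (Z E : DerivedCategory C) (z : Z ⟶ X) (e : X ⟶ E) (d : E ⟶ Z⟦(1 : ℤ)⟧),
      Triangle.mk z e d ∈ distTriang (DerivedCategory C) ∧
      IsStalkSum (IsWeakSyzygy 1) Z ∧ IsStalkSum (IsWeakSyzygy 1) E := by
  -- The maximum keeps the number of steps nonnegative even if `b < a`.
  have hb : X.IsLE (max a b) := TStructure.t.isLE_of_le X b _ (le_max_right _ _)
  obtain ⟨j, hj⟩ := Int.eq_ofNat_of_zero_le (show 0 ≤ max a b - (a - 1) by lia)
  obtain ⟨W, Y, f, p, q, H, hY, hW⟩ := exists_cycleBoundary_approximation X (max a b) j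
  rw [show max a b - (j : ℤ) = a - 1 by lia] at hY hW
  rw [sub_add_cancel] at hW
  have : Y.IsGE (a - 1) := by
    have := hW.1
    exact TStructure.t.isGE₂ _ (rot_of_distTriang _ H) (a - 1) (TStructure.t.isGE_of_ge X (a - 1) a)
      (TStructure.t.isGE_shift W a 1 (a - 1))
  obtain ⟨M, ⟨i⟩⟩ := exists_iso_singleFunctor_obj_of_isGE_of_isLE Y (a - 1)
  let φ : (singleFunctor C a).obj M ≅ Y⟦(-1 : ℤ)⟧ :=
    (singleShiftIso M (-1) a (a - 1) (by lia)).symm ≪≫ (shiftFunctor _ (-1 : ℤ)).mapIso i.symm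
  have H₀ := distinguished_of_iso₁ (inv_rot_of_distTriang _ H) φ
  -- The last object `M` need not be projective. But a subobject of `M` killed in `W` factors
  -- through `X⟦-1⟧`, which lives in degrees `≥ a + 1`, so it is zero.
  obtain ⟨-, A, Z, E, z, e, d, Hz, hA, hZ, -, hE, -⟩ := hW.cone H₀ (fun K k _ hk => by
    obtain ⟨y, hy⟩ := Triangle.coyoneda_exact₂ _ (inv_rot_of_distTriang _ H₀) _ hk
    have hy0 : y = 0 := TStructure.t.zero_of_isLE_of_isGE y a (a + 1) (by lia) inferInstance
      (TStructure.t.isGE_shift X a (-1) (a + 1))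
    rw [hy0, zero_comp] at hy
    have hk0 : k = 0 := (singleFunctor C a).map_injective (hy.trans ((singleFunctor C a).map_zero _ _).symm)
    have : Mono (0 : K ⟶ (0 : C)) :=
      ⟨fun _ _ _ => (IsZero.of_mono_eq_zero k hk0).eq_of_tgt _ _⟩
    exact isWeakSyzygy_one_of_mono (0 : K ⟶ (0 : C)))
  exact ⟨_, _, _, _, _, Hz, .biprod (.single _ _ hA) hZ, hE⟩

end CycleBoundary

/-! ### Raising the order of the syzygies by one. -/

section SyzygyStep

open Pretriangulated Triangulated Category DerivedCategory ZeroObject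

/-- A product of two objects is isomorphic to their biproduct. -/
noncomputable def piWalkingPairIso {D : Type u} [Category.{v} D] [HasZeroMorphisms D]
    [HasBinaryBiproducts D] (F : WalkingPair → D) [HasProduct F] :
    ∏ᶜ F ≅ F .left ⊞ F .right where
  hom := biprod.lift (Pi.π F .left) (Pi.π F .right)
  inv := Pi.lift (fun j => WalkingPair.casesOn j biprod.fst biprod.snd)
  hom_inv_id := by
    apply Pi.hom_ext
    rintro (_ | _) <;> simp
  inv_hom_id := by
    apply biprod.hom_ext <;> simp

variable {C : Type u} [Category.{v} C] [Abelian C] [HasDerivedCategory.{w} C]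

lemma IsStalkSum.piWalkingPair {P : ObjectProperty C} {F : WalkingPair → DerivedCategory C}
    (hF : ∀ j, IsStalkSum P (F j)) : IsStalkSum P (∏ᶜ F) :=
  .of_iso (piWalkingPairIso F).symm (.biprod (hF _) (hF _))

/-- The condition that `K` is the shift of a syzygy of `X` with respect to direct sums of stalk
complexes of projective objects; such sums map trivially to `K`. -/
def HasStalkSyzygy (k : ℕ) (X : DerivedCategory C) : Prop :=
  ∃ (R K : DerivedCategory C) (r : R ⟶ X) (x : X ⟶ K) (d : K ⟶ R⟦(1 : ℤ)⟧),
    Triangle.mk r x d ∈ distTriang (DerivedCategory C) ∧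
    IsStalkSum (fun P => Projective P) R ∧ IsStalkSum (IsWeakSyzygy k) K ∧
    ∀ (P : C) (i : ℤ) (f : (singleFunctor C i).obj P ⟶ X), Projective P → f ≫ x = 0

lemma HasStalkSyzygy.of_iso {k : ℕ} {X Y : DerivedCategory C} (e : X ≅ Y)
    (h : HasStalkSyzygy k X) : HasStalkSyzygy k Y := by
  obtain ⟨R, K, r, x, d, H, hR, hK, h⟩ := h
  refine ⟨R, K, r ≫ e.hom, e.inv ≫ x, d, isomorphic_distinguished _ H _
    (Triangle.isoMk _ _ (Iso.refl _) e.symm (Iso.refl _) ?_ ?_ ?_), hR, hK, fun P i f hP => ?_⟩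
  · change (r ≫ e.hom) ≫ e.inv = 𝟙 R ≫ r
    simp
  · exact comp_id _
  · change d ≫ (𝟙 R)⟦(1 : ℤ)⟧' = 𝟙 K ≫ d
    simp
  · rw [← assoc, h P i _ hP]

lemma HasStalkSyzygy.piWalkingPair {k : ℕ} {F : WalkingPair → DerivedCategory C}
    (hF : ∀ j, HasStalkSyzygy k (F j)) : HasStalkSyzygy k (∏ᶜ F) := by
  choose R K r x d H hR hK h using hF
  refine ⟨_, _, _, _, _, productTriangle_distinguished _ H, .piWalkingPair hR, .piWalkingPair hK,
    fun P i f hP => ?_⟩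
  refine Pi.hom_ext (f := K) _ _ fun j => ?_
  have : (Limits.Pi.map x : ∏ᶜ F ⟶ ∏ᶜ K) ≫ Pi.π K j = Pi.π F j ≫ x j := by simp
  change (f ≫ (Limits.Pi.map x : ∏ᶜ F ⟶ ∏ᶜ K)) ≫ Pi.π K j = 0 ≫ Pi.π K j
  rw [assoc, this, ← assoc, h j P i _ hP, zero_comp]

/-- The triangle is the rotation of `0 ⟶ K ⟶ P ⟶ M ⟶ 0`. A projective stalk in degree `i ≥ n` has no
map to `K⟦1⟧`, which lies in degree `n - 1`. One in degree `i < n` has no map to `M` in degree `n`.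
-/
lemma HasStalkSyzygy.single [EnoughProjectives C] {k : ℕ} {M : C} (hM : IsWeakSyzygy k M)
    (n : ℤ) : HasStalkSyzygy (k + 1) ((singleFunctor C n).obj M) := by
  have hS : (ShortComplex.mk (kernel.ι (Projective.π M)) (Projective.π M) (by simp)).ShortExact :=
    { exact := ShortComplex.exact_kernel _ }
  obtain ⟨δ, Hδ⟩ := exists_stalk_triangle _ _ _ hS n
  have hK : IsWeakSyzygy (k + 1) (kernel (Projective.π M)) :=
    ⟨_, _, _, _, _, hS, inferInstance, hM⟩
  refine ⟨_, _, _, δ, _, rot_of_distTriang _ Hδ, .single _ n (Projective.projective_over M),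
    .shift (.single _ n hK) 1, fun P i f hP => ?_⟩
  by_cases hi : n ≤ i
  · have : IsLE (((singleFunctor C n).obj (kernel (Projective.π M)))⟦(1 : ℤ)⟧) (n - 1) :=
      TStructure.t.isLE_shift _ n 1 (n - 1)
    exact eq_zero_of_projective_of_isLE (n := n - 1) (by lia) _
  · rw [TStructure.t.zero_of_isLE_of_isGE f i n (by lia) inferInstance inferInstance, zero_comp]

lemma IsStalkSum.hasStalkSyzygy [EnoughProjectives C] {k : ℕ} {X : DerivedCategory C}
    (h : IsStalkSum (IsWeakSyzygy k) X) : HasStalkSyzygy (k + 1) X := by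
  induction h with
  | single M n h => exact .single h n
  | @biprod X Y _ _ h₁ h₂ =>
    refine .of_iso (piWalkingPairIso (pairFunction X Y)) (.piWalkingPair ?_)
    rintro (_ | _)
    exacts [h₁, h₂]
  | of_iso e _ h => exact .of_iso e h

lemma IsStalkSum.comp_eq_zero {P : ObjectProperty C} {Y Y' : DerivedCategory C} (g : Y ⟶ Y')
    (hg : ∀ (M : C) (i : ℤ) (f : (singleFunctor C i).obj M ⟶ Y), P M → f ≫ g = 0)
    {Q : DerivedCategory C} (hQ : IsStalkSum P Q) (f : Q ⟶ Y) : f ≫ g = 0 := by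
  induction hQ with
  | single M n h => exact hg M n f h
  | biprod _ _ h₁ h₂ =>
    apply biprod.hom_ext'
    · rw [← assoc, h₁, comp_zero]
    · rw [← assoc, h₂, comp_zero]
  | of_iso e _ h => rw [← cancel_epi e.hom, ← assoc, h, comp_zero]

/-- An extension of two direct sums of `k`-th syzygies is, up to an extension by a direct sum of
projective objects, an extension of two direct sums of `(k + 1)`-th syzygies. -/
lemma exists_syzygy_triangle [EnoughProjectives C] {k : ℕ} {Z X E : DerivedCategory C}
    {z : Z ⟶ X} {e : X ⟶ E} {d : E ⟶ Z⟦(1 : ℤ)⟧}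
    (H : Triangle.mk z e d ∈ distTriang (DerivedCategory C))
    (hZ : IsStalkSum (IsWeakSyzygy k) Z) (hE : IsStalkSum (IsWeakSyzygy k) E) :
    ∃ (R X' : DerivedCategory C) (r : R ⟶ X) (x : X ⟶ X') (c : X' ⟶ R⟦(1 : ℤ)⟧)
      (Z' E' : DerivedCategory C) (z' : Z' ⟶ X') (e' : X' ⟶ E') (d' : E' ⟶ Z'⟦(1 : ℤ)⟧),
      Triangle.mk r x c ∈ distTriang (DerivedCategory C) ∧
      IsStalkSum (fun P => Projective P) R ∧
      Triangle.mk z' e' d' ∈ distTriang (DerivedCategory C) ∧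
      IsStalkSum (IsWeakSyzygy (k + 1)) Z' ∧ IsStalkSum (IsWeakSyzygy (k + 1)) E' := by
  obtain ⟨R, K, r, κ, c, HR, hR, hK, hκ⟩ := hZ.hasStalkSyzygy
  obtain ⟨Q, L, q, l, _, HQ, hQ, hL, -⟩ := hE.hasStalkSyzygy
  obtain ⟨Y, y, _, HY⟩ := distinguished_cocone_triangle (r ≫ z)
  -- Dividing `R` out of both `Z` and `X` gives a triangle `K ⟶ Y ⟶ E`, whose connecting map factors
  -- through `κ⟦1⟧`. Hence `Q ⟶ E` lifts to `Y`, and `Y` is an extension of `L` by `K ⊞ Q`.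
  let o := someOctahedron rfl HR H HY
  have h0 : ∀ (P : C) (i : ℤ) (f : (singleFunctor C i).obj P ⟶ Z⟦(1 : ℤ)⟧), Projective P →
      f ≫ κ⟦(1 : ℤ)⟧' = 0 := by
    intro P i f hP
    let ψ := singleShiftIso P 1 i (i + 1) (by lia)
    obtain ⟨g, hg⟩ := (shiftFunctor (DerivedCategory C) (1 : ℤ)).map_surjective (ψ.hom ≫ f)
    rw [← cancel_epi ψ.hom, ← assoc, ← hg, ← CategoryTheory.Functor.map_comp, hκ P _ g hP,
      Functor.map_zero, comp_zero]
  obtain ⟨z', d', H'⟩ := exists_triangle_of_lift o.mem HQ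
    (by rw [← assoc]; exact hQ.comp_eq_zero _ h0 _)
  exact ⟨R, Y, _, y, _, _, _, z', _, d', HY, hR, H',
    .biprod hK (.of_le (fun P (hP : Projective P) => isWeakSyzygy_of_projective _ P) hQ), hL⟩

/-- The generation statement for a family of classes of objects that is compatible with
extensions. -/
lemma of_triangle_isStalkSum [EnoughProjectives C] (G : ℕ → ObjectProperty (DerivedCategory C))
    (hG : ∀ (a b : ℕ) {X Y Z : DerivedCategory C} {f : X ⟶ Y} {g : Y ⟶ Z} {h : Z ⟶ X⟦(1 : ℤ)⟧},
      Triangle.mk f g h ∈ distTriang (DerivedCategory C) → G a X → G b Z → G (a + b + 1) Y)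
    (hP : IsStalkSum (fun P : C => Projective P) ≤ G 0) {m k j : ℕ}
    (hS : IsStalkSum (IsWeakSyzygy (C := C) (k + j)) ≤ G m) {Z X E : DerivedCategory C}
    {z : Z ⟶ X} {e : X ⟶ E} {d : E ⟶ Z⟦(1 : ℤ)⟧}
    (H : Triangle.mk z e d ∈ distTriang (DerivedCategory C))
    (hZ : IsStalkSum (IsWeakSyzygy k) Z) (hE : IsStalkSum (IsWeakSyzygy k) E) :
    G (2 * m + 1 + j) X := by
  induction j generalizing k Z X E with
  | zero =>
    have := hG m m H (hS _ hZ) (hS _ hE)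
    rwa [← two_mul] at this
  | succ j ih =>
    obtain ⟨R, X', r, x, c, Z', E', z', e', d', HR, hR, H', hZ', hE'⟩ :=
      exists_syzygy_triangle H hZ hE
    have h := hG 0 _ HR (hP _ hR) (ih (k := k + 1) (by rwa [add_assoc, add_comm 1 j]) H' hZ' hE')
    rwa [zero_add, add_assoc _ j 1] at h

end SyzygyStep

/-! ### Closure properties of the classes `⟨G⟩_{k+1}`. -/

section EnvelopeLemmas

open Pretriangulated Triangulated Category

section Products

variable {T : Type u} [Category.{v} T] [HasZeroObject T] [HasShift T ℤ] [Preadditive T]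
  [∀ k : ℤ, (shiftFunctor T k).Additive] [Pretriangulated T]

lemma retractClosure_pi {P : ObjectProperty T}
    (hP : ∀ F : WalkingPair → T, (∀ j, P (F j)) → P (∏ᶜ F)) (F : WalkingPair → T)
    (hF : ∀ j, P.retractClosure (F j)) : P.retractClosure (∏ᶜ F) := by
  choose G hG r using hF
  refine ⟨∏ᶜ G, hP G hG, ⟨⟨Limits.Pi.map fun j => (r j).some.i, Limits.Pi.map fun j => (r j).some.r,
    ?_⟩⟩⟩
  apply Limits.Pi.hom_ext
  intro j
  simp

lemma extensionProduct_pi {P Q : ObjectProperty T}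
    (hP : ∀ F : WalkingPair → T, (∀ j, P (F j)) → P (∏ᶜ F))
    (hQ : ∀ F : WalkingPair → T, (∀ j, Q (F j)) → Q (∏ᶜ F)) (F : WalkingPair → T)
    (hF : ∀ j, P.extensionProduct Q (F j)) : P.extensionProduct Q (∏ᶜ F) := by
  choose X Z f g h H hX hZ using hF
  exact ⟨_, _, _, _, _, productTriangle_distinguished _ H, hP X hX, hQ Z hZ⟩

/-- Induction on the number of extensions: products of distinguished triangles are distinguished,
and products of retracts are retracts. -/
lemma triangEnvelopeIter_pi (P : ObjectProperty T) (n : ℕ) (F : WalkingPair → T)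
    (hF : ∀ j, P.triangEnvelopeIter n (F j)) : P.triangEnvelopeIter n (∏ᶜ F) := by
  have h0 : ∀ F : WalkingPair → T,
      (∀ j, (P.shiftClosure ℤ).binaryProductsClosure.retractClosure (F j)) →
      (P.shiftClosure ℤ).binaryProductsClosure.retractClosure (∏ᶜ F) :=
    retractClosure_pi fun F hF => ObjectProperty.prop_limit _ _ fun j => hF j.as
  induction n generalizing F with
  | zero =>
    rw [ObjectProperty.triangEnvelopeIter_zero] at hF ⊢
    exact h0 F hF
  | succ n ih =>
    rw [ObjectProperty.triangEnvelopeIter_succ] at hF ⊢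
    exact retractClosure_pi (extensionProduct_pi h0 ih) F hF

lemma triangEnvelopeIter_biprod (P : ObjectProperty T) (n : ℕ) {X Y : T}
    (hX : P.triangEnvelopeIter n X) (hY : P.triangEnvelopeIter n Y) :
    P.triangEnvelopeIter n (X ⊞ Y) := by
  refine (P.triangEnvelopeIter n).prop_of_iso (piWalkingPairIso (pairFunction X Y))
    (triangEnvelopeIter_pi P n _ ?_)
  rintro (_ | _)
  exacts [hX, hY]

lemma triangEnvelopeIter_of_triangle [IsTriangulated T] (P : ObjectProperty T) (a b : ℕ)
    {X Y Z : T} {f : X ⟶ Y} {g : Y ⟶ Z} {h : Z ⟶ X⟦(1 : ℤ)⟧}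
    (H : Triangle.mk f g h ∈ distTriang T) (hX : P.triangEnvelopeIter a X)
    (hZ : P.triangEnvelopeIter b Z) : P.triangEnvelopeIter (a + b + 1) Y := by
  rw [add_assoc, P.triangEnvelopeIter_add' rfl]
  exact ObjectProperty.le_retractClosure _ _ ⟨_, _, _, _, _, H, hX, hZ⟩

end Products

open DerivedCategory

variable {C : Type u} [Category.{v} C] [Abelian C] [HasDerivedCategory.{w} C]

lemma bounded_of_retract {X Y : DerivedCategory C} (r : Retract X Y)
    (hY : TStructure.t.bounded Y) : TStructure.t.bounded X := by
  obtain ⟨⟨a, ha⟩, ⟨b, hb⟩⟩ := hY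
  refine ⟨⟨a, ?_⟩, ⟨b, ?_⟩⟩
  · refine (TStructure.t.isGE_iff_orthogonal (a - 1) a (by lia) X).2 fun V f hV => ?_
    rw [← comp_id f, ← r.retract, ← assoc,
      TStructure.t.zero_of_isLE_of_isGE (f ≫ r.i) (a - 1) a (by lia) hV ha, zero_comp]
  · refine (TStructure.t.isLE_iff_orthogonal b (b + 1) rfl X).2 fun V f hV => ?_
    rw [← id_comp f, ← r.retract, assoc,
      TStructure.t.zero_of_isLE_of_isGE (r.r ≫ f) b (b + 1) (by lia) hb hV, comp_zero]

/-- The objects of the derived category that are isomorphic to a bounded object obtained from `M`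
with at most `k` extensions. -/
def boundedEnvelope (M : DerivedCategory.Bounded C) (k : ℕ) :
    ObjectProperty (DerivedCategory C) := fun X =>
  ∃ Y : DerivedCategory.Bounded C, (ObjectProperty.singleton M).triangEnvelopeIter k Y ∧
    Nonempty (X ≅ Bounded.ι.obj Y)

attribute [local instance] preservesBinaryBiproducts_of_preservesBiproducts

variable {M : DerivedCategory.Bounded C} {k : ℕ}

instance : (boundedEnvelope M k).IsStableUnderRetracts where
  of_retract := by
    rintro X X' r ⟨Y, hY, ⟨e⟩⟩
    have r' := r.trans (.ofIso e)
    have hX := bounded_of_retract r' Y.2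
    refine ⟨⟨X, hX⟩, ObjectProperty.prop_of_retract _ ?_ hY, ⟨Iso.refl _⟩⟩
    exact
      { i := TStructure.t.bounded.fullyFaithfulι.preimage r'.i
        r := TStructure.t.bounded.fullyFaithfulι.preimage r'.r
        retract := TStructure.t.bounded.ι.map_injective (by simp [r'.retract]) }

lemma boundedEnvelope_biprod {X Y : DerivedCategory C} (hX : boundedEnvelope M k X)
    (hY : boundedEnvelope M k Y) : boundedEnvelope M k (X ⊞ Y) := by
  obtain ⟨X', hX', ⟨e⟩⟩ := hX
  obtain ⟨Y', hY', ⟨e'⟩⟩ := hY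
  refine ⟨X' ⊞ Y', triangEnvelopeIter_biprod _ _ hX' hY', ⟨biprod.mapIso e e' ≪≫
    (Bounded.ι.mapBiprod X' Y').symm⟩⟩

lemma boundedEnvelope_shift {X : DerivedCategory C} (hX : boundedEnvelope M k X) (n : ℤ) :
    boundedEnvelope M k (X⟦n⟧) := by
  obtain ⟨X', hX', ⟨e⟩⟩ := hX
  exact ⟨X'⟦n⟧, ObjectProperty.le_shift _ n _ hX',
    ⟨(shiftFunctor _ n).mapIso e ≪≫ ((Bounded.ι.commShiftIso n).app X').symm⟩⟩

/-- The connecting map lifts to the bounded derived category by fullness. Completing it to a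
triangle there recovers `Y` up to isomorphism. -/
lemma boundedEnvelope_of_triangle {a b : ℕ} {X Y Z : DerivedCategory C} {f : X ⟶ Y} {g : Y ⟶ Z}
    {h : Z ⟶ X⟦(1 : ℤ)⟧} (H : Triangle.mk f g h ∈ distTriang (DerivedCategory C))
    (hX : boundedEnvelope M a X) (hZ : boundedEnvelope M b Z) :
    boundedEnvelope M (a + b + 1) Y := by
  obtain ⟨X', hX', ⟨e⟩⟩ := hX
  obtain ⟨Z', hZ', ⟨e'⟩⟩ := hZ
  obtain ⟨h', hh'⟩ := Bounded.ι.map_surjective (e'.inv ≫ h ≫ e.hom⟦(1 : ℤ)⟧' ≫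
    (Bounded.ι.commShiftIso (1 : ℤ)).inv.app X')
  obtain ⟨Y', f', g', H'⟩ := distinguished_cocone_triangle₂ h'
  refine ⟨Y', triangEnvelopeIter_of_triangle _ a b H' hX' hZ',
    ⟨Triangle.π₂.mapIso (isoTriangleOfIso₁₃ _ _ H (Bounded.ι.map_distinguished _ H') e e' ?_)⟩⟩
  change h ≫ e.hom⟦(1 : ℤ)⟧' = e'.hom ≫ Bounded.ι.map h' ≫
    (Bounded.ι.commShiftIso (1 : ℤ)).hom.app X'
  rw [hh', assoc, assoc, assoc, e'.hom_inv_id_assoc]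
  refine congrArg (h ≫ ·) ((comp_id _).symm.trans (congrArg (e.hom⟦(1 : ℤ)⟧' ≫ ·) ?_))
  exact ((Bounded.ι.commShiftIso (1 : ℤ)).inv_hom_id_app X').symm

instance : (boundedEnvelope M k).IsClosedUnderBinaryProducts where
  limitsOfShape_le := by
    rintro X ⟨p⟩
    refine (boundedEnvelope M k).prop_of_iso ?_
      (boundedEnvelope_biprod (p.prop_diag_obj (.mk .left)) (p.prop_diag_obj (.mk .right)))
    exact biprod.isoProd _ _ ≪≫ IsLimit.conePointUniqueUpToIso (prodIsProd _ _)
      ((IsLimit.postcomposeHomEquiv (diagramIsoPair p.diag) _).2 p.isLimit)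

lemma isStalkSum_le_boundedEnvelope {P : ObjectProperty C}
    (hP : ∀ N : C, P N → boundedEnvelope M k ((singleFunctor C 0).obj N)) :
    IsStalkSum P ≤ boundedEnvelope M k := by
  intro X hX
  induction hX with
  | single N n hN =>
    exact (boundedEnvelope M k).prop_of_iso (singleShiftIso N (-n) n 0 (by lia))
      (boundedEnvelope_shift (hP N hN) (-n))
  | biprod _ _ h₁ h₂ => exact boundedEnvelope_biprod h₁ h₂
  | of_iso e _ h => exact (boundedEnvelope M k).prop_of_iso e h

end EnvelopeLemmas

/-! ### Schanuel's lemma and `add V`-resolutions. -/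

section SyzygyComparison

open Pretriangulated Triangulated Category DerivedCategory

variable {C : Type u} [Category.{v} C] [Abelian C]

/-- A form of Schanuel's lemma: if `L` is a retract of `N`, then the syzygies of `L` are retracts
of the syzygies of `N`, up to projective summands. -/
lemma exists_retract_syzygy {K P L K' A N : C} {k : K ⟶ P} {p : P ⟶ L} {w : k ≫ p = 0}
    (hS : (ShortComplex.mk k p w).ShortExact) [Projective P] [Projective A] {k' : K' ⟶ A}
    {q : A ⟶ N} [Epi q] (hk' : k' ≫ q = 0)
    (hq : ∀ {X : C} (x : X ⟶ A), x ≫ q = 0 → ∃ y : X ⟶ K', x = y ≫ k') (r : Retract L N) :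
    Nonempty (Retract K (K' ⊞ P)) := by
  have : Epi p := hS.epi_g
  have : Mono k := hS.mono_f
  have hk : ∀ {X : C} (x : X ⟶ P), x ≫ p = 0 → ∃ y : X ⟶ K, x = y ≫ k := fun x hx =>
    ⟨hS.exact.lift x hx, (hS.exact.lift_f x hx).symm⟩
  let a : P ⟶ A := Projective.factorThru (p ≫ r.i) q
  have ha : a ≫ q = p ≫ r.i := Projective.factorThru_comp _ _
  let b : A ⟶ P := Projective.factorThru (q ≫ r.r) p
  have hb : b ≫ p = q ≫ r.r := Projective.factorThru_comp _ _
  obtain ⟨α, hα⟩ := hq (k ≫ a) (by rw [assoc, ha, ← assoc, w, zero_comp])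
  obtain ⟨β, hβ⟩ := hk (k' ≫ b) (by rw [assoc, hb, ← assoc, hk', zero_comp])
  -- Since `a ≫ b` lifts the identity of `L`, its defect from `𝟙 P` lands in `K`. Restricted to `K`
  -- this says `α ≫ β + k ≫ γ = 𝟙 K`.
  obtain ⟨γ, hγ⟩ := hk (𝟙 P - a ≫ b) (by
    rw [Preadditive.sub_comp, assoc, hb, ← assoc, ha, assoc, r.retract, id_comp, comp_id, sub_self])
  refine ⟨⟨biprod.lift α k, biprod.desc β γ, ?_⟩⟩
  rw [← cancel_mono k, biprod.lift_desc, Preadditive.add_comp, assoc, assoc, ← hβ, ← hγ, ← assoc,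
    ← hα, Preadditive.comp_sub, comp_id, assoc, id_comp, add_sub_cancel]

/-- An iterated weak syzygy is a retract of the corresponding syzygy of some object, up to
projective summands. -/
lemma IsWeakSyzygy.exists_retract {n : ℕ} {K : C} (hK : IsWeakSyzygy n K) :
    ∃ M : C, ∀ K' : C, IsSyzygy n M K' →
      ∃ Q : C, Projective Q ∧ Nonempty (Retract K (K' ⊞ Q)) := by
  induction n generalizing K with
  | zero =>
    refine ⟨K, ?_⟩
    rintro K' ⟨e⟩
    exact ⟨_, Projective.zero_projective, ⟨⟨biprod.lift e.inv 0, biprod.desc e.hom 0, by simp⟩⟩⟩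
  | succ n ih =>
    obtain ⟨P, L, k, p, w, hS, hP, hL⟩ := hK
    obtain ⟨M, hM⟩ := ih hL
    refine ⟨M, ?_⟩
    rintro K' ⟨L', P', f, hL', hf, ⟨e⟩⟩
    obtain ⟨Q, hQ, ⟨r⟩⟩ := hM L' hL'
    have := hf.epi
    have := hf.projective
    have hepi : Epi (biprod.map f (𝟙 Q)) := inferInstance
    -- As `L` is a retract of `L' ⊞ Q`, Schanuel applies to the presentation `P' ⊞ Q ⟶ L' ⊞ Q`,
    -- which still has kernel `K'`.
    refine ⟨P, hP, exists_retract_syzygy hS (k' := e.hom ≫ kernel.ι f ≫ biprod.inl)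
      (q := biprod.map f (𝟙 Q)) (by simp) (fun x hx => ?_) r⟩
    have h1 : (x ≫ biprod.fst) ≫ f = 0 := by
      rw [assoc, ← biprod.map_fst f (𝟙 Q), ← assoc, hx, zero_comp]
    have h2 : x ≫ biprod.snd = 0 := by
      rw [← comp_id (x ≫ biprod.snd), assoc, ← biprod.map_snd f (𝟙 Q), ← assoc, hx, zero_comp]
    refine ⟨kernel.lift f _ h1 ≫ e.inv, ?_⟩
    apply biprod.hom_ext <;> simp [h2]

variable [HasDerivedCategory.{w} C] {G : DerivedCategory.Bounded C}

lemma boundedEnvelope_of_inAdd {V W : C} (hW : InAdd V W) {k : ℕ}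
    (hV : boundedEnvelope G k ((singleFunctor C 0).obj V)) :
    boundedEnvelope G k ((singleFunctor C 0).obj W) := by
  obtain ⟨j, ⟨r⟩⟩ := hW
  have := Abelian.hasFiniteBiproducts (C := C)
  have : (boundedEnvelope G k).Nonempty := ⟨_, hV⟩
  have : (boundedEnvelope G k).IsClosedUnderFiniteProducts := .mk'
  refine (boundedEnvelope G k).prop_of_retract (r.map (singleFunctor C 0)) ?_
  refine (boundedEnvelope G k).prop_of_iso
    (((singleFunctor C 0).mapBiproduct _) ≪≫ biproduct.isoProduct _).symm ?_
  exact ObjectProperty.prop_product _ fun _ => hV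

lemma boundedEnvelope_of_shortExact {a b : ℕ} {K P L : C} {i : K ⟶ P} {p : P ⟶ L} {w : i ≫ p = 0}
    (hS : (ShortComplex.mk i p w).ShortExact)
    (hP : boundedEnvelope G a ((singleFunctor C 0).obj P))
    (hK : boundedEnvelope G b ((singleFunctor C 0).obj K)) :
    boundedEnvelope G (a + b + 1) ((singleFunctor C 0).obj L) := by
  obtain ⟨δ, Hδ⟩ := exists_stalk_triangle _ _ _ hS 0
  exact boundedEnvelope_of_triangle (rot_of_distTriang _ Hδ) hP (boundedEnvelope_shift hK 1)

/-- Peel off `W 0`: its kernel has a resolution shorter by one, and the rotated triangle costs one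
extension. -/
lemma boundedEnvelope_of_hasAddResolution {V K : C} {m : ℕ} (hK : HasAddResolution V m K)
    (hV : boundedEnvelope G 0 ((singleFunctor C 0).obj V)) :
    boundedEnvelope G m ((singleFunctor C 0).obj K) := by
  induction m generalizing K with
  | zero =>
    obtain ⟨W, d, ε, hε, hd, hW, hW0, hepi, hex, -⟩ := hK
    have : Mono ε := hex.mono_g ((hW0 1 Nat.zero_lt_one).eq_of_src _ _)
    have : IsIso ε := isIso_of_mono_of_epi ε
    exact (boundedEnvelope G 0).prop_of_iso ((singleFunctor C 0).mapIso (asIso ε))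
      (boundedEnvelope_of_inAdd (hW 0 le_rfl) hV)
  | succ m ih =>
    obtain ⟨W, d, ε, hε, hd, hW, hW0, hepi, hex, hexd⟩ := hK
    have hS : (ShortComplex.mk (kernel.ι ε) ε (by simp)).ShortExact :=
      { exact := ShortComplex.exact_kernel ε }
    have hres : HasAddResolution V m (kernel ε) := by
      refine ⟨fun i => W (i + 1), fun i => d (i + 1), kernel.lift ε (d 0) hε, ?_,
        fun i => hd (i + 1), fun i hi => hW _ (by lia), fun i hi => hW0 _ (by lia), ?_, ?_,
        fun i => hexd (i + 1)⟩
      · rw [← cancel_mono (kernel.ι ε), assoc, kernel.lift_ι, hd, zero_comp]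
      · exact hex.epi_kernelLift
      · refine (ShortComplex.exact_iff_of_epi_of_isIso_of_mono
          (S₁ := ShortComplex.mk (d 1) (kernel.lift ε (d 0) hε) _)
          (S₂ := ShortComplex.mk (d 1) (d 0) (hd 0))
          { τ₁ := 𝟙 _, τ₂ := 𝟙 _, τ₃ := kernel.ι ε }).2 (hexd 0)
    have h := boundedEnvelope_of_shortExact hS (boundedEnvelope_of_inAdd (hW 0 (by lia)) hV)
      (ih hres)
    rwa [zero_add] at h

end SyzygyComparison

/-! ### `Λ` is a projective generator of `mod Λ`. -/

lemma projective_biproduct {C : Type u} [Category.{v} C] [HasZeroMorphisms C] {β : Type w}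
    (g : β → C) [HasBiproduct g] [∀ b, Projective (g b)] : Projective (⨁ g) where
  factors f e _ := ⟨biproduct.desc fun b => Projective.factorThru (biproduct.ι g b ≫ f) e,
    biproduct.hom_ext' _ _ fun b => by
      rw [biproduct.ι_desc_assoc, Projective.factorThru_comp]⟩

section RightModules

variable {Λ : Type u} [Ring Λ]

/-- The morphism `Λ ⟶ M` of right modules sending `1` to `x`. -/
def RightMod.ofElement {M : RightMod Λ} (x : M) : RightMod.self Λ ⟶ M :=
  ObjectProperty.homMk (ModuleCat.ofHom
    { toFun := fun a : Λ => MulOpposite.op a • x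
      map_add' := fun a b => by rw [MulOpposite.op_add, add_smul]
      map_smul' := fun c a => by
        rw [← MulOpposite.op_unop c, op_smul_eq_mul, MulOpposite.op_mul, mul_smul]
        rfl })

lemma RightMod.ofElement_apply {M : RightMod Λ} (x : M) (a : Λ) :
    (RightMod.ofElement x).hom.hom a = MulOpposite.op a • x := rfl

lemma RightMod.hom_ext_self {M : RightMod Λ} {f g : RightMod.self Λ ⟶ M}
    (h : f.hom.hom (1 : Λ) = g.hom.hom (1 : Λ)) : f = g := by
  ext
  exact h

variable [IsNoetherianRing Λᵐᵒᵖ]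

lemma RightMod.surjective_of_epi {M N : RightMod Λ} (f : M ⟶ N) [Epi f] :
    Function.Surjective f.hom.hom :=
  (ModuleCat.epi_iff_surjective _).1
    (inferInstance : Epi ((forget₂ (RightMod Λ) (ModuleCat Λᵐᵒᵖ)).map f))

instance RightMod.projective_self : Projective (RightMod.self Λ) where
  factors {E X} f e _ := by
    obtain ⟨y, hy⟩ := RightMod.surjective_of_epi e (f.hom.hom (1 : Λ))
    refine ⟨RightMod.ofElement y, RightMod.hom_ext_self ?_⟩
    change e.hom.hom ((RightMod.ofElement y).hom.hom (1 : Λ)) = _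
    rw [RightMod.ofElement_apply, MulOpposite.op_one, one_smul, hy]

attribute [local instance] Abelian.hasFiniteBiproducts

lemma RightMod.exists_epi (M : RightMod Λ) :
    ∃ (k : ℕ) (p : (⨁ fun _ : Fin k => RightMod.self Λ) ⟶ M), Epi p := by
  obtain ⟨k, s, hs⟩ := Module.Finite.exists_fin (R := Λᵐᵒᵖ) (M := M)
  refine ⟨k, biproduct.desc fun i => RightMod.ofElement (s i),
    Preadditive.epi_of_cancel_zero _ fun {N} u hu => ?_⟩
  have h : u.hom.hom = 0 := by
    refine LinearMap.ext_on_range hs fun i => ?_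
    have hi : RightMod.ofElement (s i) ≫ u = 0 := by
      rw [← biproduct.ι_desc (fun i => RightMod.ofElement (s i)) i, Category.assoc, hu, comp_zero]
    have := congrArg (fun v => v.hom.hom (1 : Λ)) hi
    change u.hom.hom ((RightMod.ofElement (s i)).hom.hom (1 : Λ)) = 0 at this
    rwa [RightMod.ofElement_apply, MulOpposite.op_one, one_smul] at this
  exact FGModuleCat.hom_ext h

instance RightMod.enoughProjectives : EnoughProjectives (RightMod Λ) where
  presentation M := by
    obtain ⟨k, p, hp⟩ := RightMod.exists_epi M
    have : Projective (⨁ fun _ : Fin k => RightMod.self Λ) :=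
      projective_biproduct _
    exact ⟨{ p := _, f := p }⟩

lemma RightMod.inAdd_self_of_projective (P : RightMod Λ) [Projective P] :
    InAdd (RightMod.self Λ) P := by
  obtain ⟨k, p, hp⟩ := RightMod.exists_epi P
  exact ⟨k, ⟨⟨Projective.factorThru (𝟙 P) p, p, Projective.factorThru_comp _ _⟩⟩⟩

end RightModules

/-! ### Counting layers. -/

section Generation

open DerivedCategory Triangulated

section

variable {C : Type u} [Category.{v} C] [Abelian C] [HasDerivedCategory.{w} C]

lemma boundedEnvelope_mono (G : Bounded C) {a b : ℕ} (h : a ≤ b) :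
    boundedEnvelope G a ≤ boundedEnvelope G b := by
  rintro X ⟨Y, hY, e⟩
  exact ⟨Y, ObjectProperty.monotone'_triangEnvelopeIter _ h _ hY, e⟩

lemma boundedEnvelope_zero_self (G : Bounded C) : boundedEnvelope G 0 (Bounded.ι.obj G) :=
  ⟨G, ObjectProperty.le_triangEnvelopeIter _ _ _ (by simp), ⟨Iso.refl _⟩⟩

lemma boundedEnvelope_stalk_left (X Y : C) :
    boundedEnvelope ((stalkZero C).obj X ⊞ (stalkZero C).obj Y) 0 ((singleFunctor C 0).obj X) :=
  let r : Retract ((stalkZero C).obj X) ((stalkZero C).obj X ⊞ (stalkZero C).obj Y) :=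
    ⟨biprod.inl, biprod.fst, biprod.inl_fst⟩
  (boundedEnvelope _ 0).prop_of_retract (r.map Bounded.ι) (boundedEnvelope_zero_self _)

lemma boundedEnvelope_stalk_right (X Y : C) :
    boundedEnvelope ((stalkZero C).obj X ⊞ (stalkZero C).obj Y) 0 ((singleFunctor C 0).obj Y) :=
  let r : Retract ((stalkZero C).obj Y) ((stalkZero C).obj X ⊞ (stalkZero C).obj Y) :=
    ⟨biprod.inr, biprod.snd, biprod.inr_snd⟩
  (boundedEnvelope _ 0).prop_of_retract (r.map Bounded.ι) (boundedEnvelope_zero_self _)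

lemma boundedEnvelope_of_isWeakSyzygy {G : Bounded C} {m n : ℕ} {K : C} (hK : IsWeakSyzygy n K)
    (hP : ∀ P : C, Projective P → boundedEnvelope G 0 ((singleFunctor C 0).obj P))
    (hS : ∀ M : C, ∃ K', IsSyzygy n M K' ∧ boundedEnvelope G m ((singleFunctor C 0).obj K')) :
    boundedEnvelope G m ((singleFunctor C 0).obj K) := by
  obtain ⟨M, hM⟩ := hK.exists_retract
  obtain ⟨K', hK', hK'm⟩ := hS M
  obtain ⟨Q, hQ, ⟨r⟩⟩ := hM K' hK'
  have := preservesBinaryBiproducts_of_preservesBiproducts (singleFunctor C 0)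
  exact (boundedEnvelope G m).prop_of_retract
    ((r.map (singleFunctor C 0)).trans (.ofIso ((singleFunctor C 0).mapBiprod K' Q)))
    (boundedEnvelope_biprod hK'm (boundedEnvelope_mono G m.zero_le _ (hP Q hQ)))

lemma generatesInSteps_of_isWeakSyzygy [EnoughProjectives C] {G : Bounded C} {m j : ℕ}
    (hP : ∀ P : C, Projective P → boundedEnvelope G 0 ((singleFunctor C 0).obj P))
    (hS : ∀ K : C, IsWeakSyzygy (1 + j) K → boundedEnvelope G m ((singleFunctor C 0).obj K)) :
    GeneratesInSteps G (2 * m + (1 + j) + 1) := by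
  change ObjectProperty.triangEnvelopeIter _ _ = ⊤
  rw [eq_top_iff]
  intro X _
  obtain ⟨⟨a, ha⟩, ⟨b, hb⟩⟩ := X.2
  obtain ⟨Z, E, z, e, d, H, hZ, hE⟩ := exists_triangle_isStalkSum X.1 a b
  obtain ⟨Y, hY, ⟨i⟩⟩ := of_triangle_isStalkSum (boundedEnvelope G)
    (fun _ _ _ _ _ _ _ _ => boundedEnvelope_of_triangle) (isStalkSum_le_boundedEnvelope hP)
    (isStalkSum_le_boundedEnvelope hS) H hZ hE
  rw [← add_assoc]
  exact ObjectProperty.prop_of_iso _ (TStructure.t.bounded.fullyFaithfulι.preimageIso i).symm hY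

end

variable {Λ : Type u} [Ring Λ] [IsArtinAlgebra Λ] [HasDerivedCategory.{w} (RightMod Λ)]

lemma RightMod.boundedEnvelope_of_projective (V P : RightMod Λ) (_ : Projective P) :
    boundedEnvelope ((stalkZero (RightMod Λ)).obj (RightMod.self Λ) ⊞
      (stalkZero (RightMod Λ)).obj V) 0 ((singleFunctor _ 0).obj P) :=
  boundedEnvelope_of_inAdd (RightMod.inAdd_self_of_projective P) (boundedEnvelope_stalk_left _ _)

lemma IsIgusaTodorovModule.generatesInSteps_of_pos {m n : ℕ} {V : RightMod Λ}
    (hV : IsIgusaTodorovModule m n V) (hn : 1 ≤ n) :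
    GeneratesInSteps
      ((stalkZero (RightMod Λ)).obj (RightMod.self Λ) ⊞ (stalkZero (RightMod Λ)).obj V)
      (2 * m + n + 1) := by
  -- Of the `n = 1 + j` syzygies, the first comes from the cycle-boundary triangle and the other `j`
  -- cost one projective layer each.
  obtain ⟨j, rfl⟩ := Nat.exists_eq_add_of_le hn
  refine generatesInSteps_of_isWeakSyzygy (RightMod.boundedEnvelope_of_projective V) fun K hK =>
    boundedEnvelope_of_isWeakSyzygy hK (RightMod.boundedEnvelope_of_projective V) fun M => ?_
  obtain ⟨K', hK', hres⟩ := hV M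
  exact ⟨K', hK', boundedEnvelope_of_hasAddResolution hres (boundedEnvelope_stalk_right _ _)⟩

/-- Every module, in particular every first syzygy, is its own `Ω⁰`, so the cycle-boundary triangle
suffices without further syzygy steps. -/
lemma IsIgusaTodorovModule.generatesInSteps_of_zero {m : ℕ} {V : RightMod Λ}
    (hV : IsIgusaTodorovModule m 0 V) :
    GeneratesInSteps
      ((stalkZero (RightMod Λ)).obj (RightMod.self Λ) ⊞ (stalkZero (RightMod Λ)).obj V)
      (2 * m + 1 + 1) := by
  refine generatesInSteps_of_isWeakSyzygy (j := 0) (RightMod.boundedEnvelope_of_projective V)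
    fun K _ => ?_
  obtain ⟨K', ⟨e⟩, hres⟩ := hV K
  exact (boundedEnvelope _ m).prop_of_iso ((singleFunctor _ 0).mapIso e)
    (boundedEnvelope_of_hasAddResolution hres (boundedEnvelope_stalk_right _ _))

lemma GeneratesInSteps.triangDim_le {T : Type u} [Category.{v} T] [HasZeroObject T] [HasShift T ℤ]
    [Preadditive T] [∀ k : ℤ, (shiftFunctor T k).Additive] [Pretriangulated T] {M : T} {d : ℕ}
    (h : GeneratesInSteps M (d + 1)) : triangDim T ≤ d :=
  iInf₂_le d ⟨M, h⟩

end Generation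

theorem mainTheorem4 (Λ : Type u) [Ring Λ] [IsArtinAlgebra Λ]
    [HasDerivedCategory.{w} (RightMod Λ)] (m n : ℕ) (hΛ : IsIgusaTodorovAlgebra Λ m n) :
    triangDim (DerivedCategory.Bounded (RightMod Λ)) ≤ ((2 * m + max 1 n : ℕ) : ℕ∞) ∧
    (1 ≤ n →
      triangDim (DerivedCategory.Bounded (RightMod Λ)) ≤ ((2 * m + n : ℕ) : ℕ∞) ∧
      ∀ V : RightMod Λ, IsIgusaTodorovModule m n V →
        GeneratesInSteps
          ((stalkZero (RightMod Λ)).obj (RightMod.self Λ) ⊞ (stalkZero (RightMod Λ)).obj V)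
          (2 * m + n + 1)) := by
  obtain ⟨V, hV⟩ := hΛ
  refine ⟨?_, fun hn => ⟨(hV.generatesInSteps_of_pos hn).triangDim_le,
    fun W hW => hW.generatesInSteps_of_pos hn⟩⟩
  rcases n.eq_zero_or_pos with rfl | hn
  · exact hV.generatesInSteps_of_zero.triangDim_le
  · rw [max_eq_right hn]
    exact (hV.generatesInSteps_of_pos hn).triangDim_le
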